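/- Let $\mathbb{T}^+$ be $\{0,1,2,\dots\}$ or $[0,\infty)$, let $(\Omega,\mathcal F,(\mathcal F_t)_{t\in\mathbb{T}^+},\mathbb P)$ be a filtered probability space, $\mathcal F_+=\sigma(\mathcal F_t:t\in\mathbb{T}^+)$, and let $(\theta^t)_{t\in\mathbb{T}^+}$ be $\mathbb P$-preserving measurable maps of $\Omega$ with $\theta^0=\mathrm{id}$, $\theta^{s+t}=\theta^t\circ\theta^s$, such that for all $s,t$ the map $\theta^t$ is $(\mathcal F_{s+t},\mathcal F_s)$-measurable and $\mathcal F_t$ is independent of $(\theta^t)^{-1}\mathcal F_+$. Assume that every $\theta^t$ is an automorphism of the measurable space $(\Omega,\mathcal F)$, and that $\mathbb P$ is ergodic: each $E\in\mathcal F$ with $\mathbb P((\theta^t)^{-1}E\,\triangle\,E)=0$ for all $t\in\mathbb{T}^+$ has $\mathbb P(E)\in\{0,1\}$. Put $\mathcal F_-=\sigma(\theta^t E: t\in\mathbb{T}^+,\,E\in\mathcal F_t)$. Let $\mathbb S^1=\mathbb R/\mathbb Z$ with its usual metric, and let $\varphi(t,\omega)$ ($t\in\mathbb{T}^+$, $\omega\in\Omega$)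 be orientation-preserving homeomorphisms of $\mathbb S^1$ such that $(\omega,x)\mapsto\varphi(t,\omega)x$ is $\mathcal F_t\otimes\mathcal B(\mathbb S^1)$-measurable for each $t$; $\varphi(0,\omega)=\mathrm{id}$; $\varphi(s+t,\omega)=\varphi(t,\theta^s\omega)\circ\varphi(s,\omega)$; and, for each $\omega$, whenever $x_n\to x$, one has $\varphi(t_n,\omega)x_n\to\varphi(t,\omega)x$ if $(t_n)$ decreases to $t$, and $\varphi(t_n,\omega)x_n\to\varphi_-(t,\omega,x)$ if $(t_n)$ is strictly increasing with limit $t$, for some function $\varphi_-:\mathbb{T}^+\times\Omega\times\mathbb S^1\to\mathbb S^1$. A point $s\in\mathbb S^1$ is a crack point of $\omega$ if $\operatorname{diam}(\varphi(t,\omega)A)\to0$ as $t\to\infty$ for every $A\subset\mathbb S^1$ with $s\notin\bar A$. A measurable $q:\Omega\to\mathbb S^1$ is a random fixed point if for each $t$, $\varphi(t,\omega)q(\omega)=q(\theta^t\omega)$ for $\mathbb P$-almost all $\omega$, and $\boldsymbol\delta_q$ denotes the law of $\omega\mapsto(\omega,q(\omega))$ under $\mathbb P$. An invariant measure of $\varphi$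 is a probability measure on $(\Omega\times\mathbb S^1,\mathcal F\otimes\mathcal B(\mathbb S^1))$ with marginal $\mathbb P$ on $\Omega$ that is invariant under $(\omega,x)\mapsto(\theta^t\omega,\varphi(t,\omega)x)$ for all $t\in\mathbb{T}^+$. Theorem. Suppose that $\mathbb P$-almost every $\omega$ has a crack point, and let $r:\Omega\to\mathbb S^1$ be a measurable function such that $r(\omega)$ is the crack point of $\omega$ for every $\omega$ that has one. Then $r$ is a random fixed point that agrees $\mathbb P$-almost surely with an $\mathcal F_+$-measurable function, and either (A) $\boldsymbol\delta_r$ is the only invariant measure of $\varphi$; or (B) there is an $\mathcal F_-$-measurable random fixed point $a:\Omega\to\mathbb S^1$ with $a(\omega)\ne r(\omega)$ for $\mathbb P$-almost every $\omega$, such that the set of invariant measures of $\varphi$ is $\{\lambda\boldsymbol\delta_r+(1-\lambda)\boldsymbol\delta_a:\lambda\in[0,1]\}$. -/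

import Mathlib

open MeasureTheory ProbabilityTheory Filter Topology
open scoped NNReal

namespace CircleRDS

/-- The two possible sets of times, as additive submonoids of `[0, ∞)`:
`{0, 1, 2, …}` and `[0, ∞)` itself. -/
def IsTimeSet (T : AddSubmonoid ℝ≥0) : Prop :=
  T = AddMonoidHom.mrange (Nat.castAddMonoidHom ℝ≥0) ∨ T = ⊤

section Noise

variable {Ω : Type*} {m : MeasurableSpace Ω} {T : AddSubmonoid ℝ≥0}

/-- The future σ-algebra, generated by all the `ℱ t`. -/
abbrev futureSigma (ℱ : Filtration T m) : MeasurableSpace Ω := ⨆ t, ℱ t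

/-- The past σ-algebra, generated by the images `θ t '' E` with `E ∈ ℱ t`. -/
abbrev pastSigma (ℱ : Filtration T m) (θ : T → Ω → Ω) : MeasurableSpace Ω :=
  MeasurableSpace.generateFrom
    {S | ∃ (t : T) (E : Set Ω), MeasurableSet[ℱ t] E ∧ S = θ t '' E}

/-- Stationary memoryless noise: a measure-preserving semigroup `θ` on a filtered space, where
`ℱ t` is the information available between time `0` and time `t`. -/
structure IsMemorylessNoise (P : Measure Ω) (ℱ : Filtration T m) (θ : T → Ω → Ω) : Prop where
  measurePreserving : ∀ t, MeasurePreserving (θ t) P P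
  map_zero : θ 0 = id
  map_add : ∀ s t, θ (s + t) = θ t ∘ θ s
  shift_measurable : ∀ s t, Measurable[ℱ (s + t), ℱ s] (θ t)
  indep : ∀ t, Indep (ℱ t) ((futureSigma ℱ).comap (θ t)) P

/-- Two-sided time: every `θ t` is an automorphism of the measurable space `Ω`. -/
def IsTwoSided {Ω : Type*} [MeasurableSpace Ω] (θ : T → Ω → Ω) : Prop :=
  ∀ t, ∃ e : Ω ≃ᵐ Ω, ∀ ω, e ω = θ t ω

/-- Ergodicity of `P` for the semigroup `θ`: measurable sets that are invariant modulo null sets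
under every `θ t` are trivial. -/
def IsErgodicFlow (P : Measure Ω) (θ : T → Ω → Ω) : Prop :=
  ∀ E : Set Ω, MeasurableSet E → (∀ t, θ t ⁻¹' E =ᵐ[P] E) → P E = 0 ∨ P E = 1

end Noise

/-- A homeomorphism of the circle `ℝ / ℤ` preserves orientation if it has an increasing lift. -/
def OrientationPreserving (f : UnitAddCircle ≃ₜ UnitAddCircle) : Prop :=
  ∃ F : ℝ → ℝ, Continuous F ∧ StrictMono F ∧ (∀ x, F (x + 1) = F x + 1) ∧
    ∀ x : ℝ, ((F x : ℝ) : UnitAddCircle) = f (x : UnitAddCircle)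

section RDS

variable {Ω : Type*} {m : MeasurableSpace Ω} {T : AddSubmonoid ℝ≥0}

/-- `φ` is an invertible càdlàg random dynamical system on the circle over the noise `θ`. -/
structure IsRDS (ℱ : Filtration T m) (θ : T → Ω → Ω)
    (φ : T → Ω → UnitAddCircle ≃ₜ UnitAddCircle) : Prop where
  orientationPreserving : ∀ t ω, OrientationPreserving (φ t ω)
  measurable : ∀ t, Measurable[(ℱ t).prod inferInstance]
    (fun p : Ω × UnitAddCircle => φ t p.1 p.2)
  map_zero : ∀ ω x, φ 0 ω x = x
  cocycle : ∀ s t ω x, φ (s + t) ω x = φ t (θ s ω) (φ s ω x)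
  right_continuous : ∀ (ω : Ω) (t : T) (x : UnitAddCircle) (u : ℕ → T) (y : ℕ → UnitAddCircle),
    Antitone u → Tendsto u atTop (𝓝 t) → Tendsto y atTop (𝓝 x) →
      Tendsto (fun n => φ (u n) ω (y n)) atTop (𝓝 (φ t ω x))
  left_limits : ∃ φ' : T → Ω → UnitAddCircle → UnitAddCircle,
    ∀ (ω : Ω) (t : T) (x : UnitAddCircle) (u : ℕ → T) (y : ℕ → UnitAddCircle),
      StrictMono u → Tendsto u atTop (𝓝 t) → Tendsto y atTop (𝓝 x) →
        Tendsto (fun n => φ (u n) ω (y n)) atTop (𝓝 (φ' t ω x))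

/-- `s` is a crack point of the sample point `ω`. -/
def IsCrackPoint (φ : T → Ω → UnitAddCircle ≃ₜ UnitAddCircle) (ω : Ω) (s : UnitAddCircle) : Prop :=
  ∀ A : Set UnitAddCircle, s ∉ closure A →
    Tendsto (fun t : T => Metric.diam (φ t ω '' A)) atTop (𝓝 0)

/-- The set of contractive sample points, i.e. those that admit a crack point. -/
def contractiveSet (φ : T → Ω → UnitAddCircle ≃ₜ UnitAddCircle) : Set Ω :=
  {ω | ∃ s, IsCrackPoint φ ω s}

/-- A measurable `q : Ω → ℝ / ℤ` is a random fixed point of `φ`. -/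
structure IsRandomFixedPoint (P : Measure Ω) (θ : T → Ω → Ω)
    (φ : T → Ω → UnitAddCircle ≃ₜ UnitAddCircle) (q : Ω → UnitAddCircle) : Prop where
  measurable : Measurable q
  fixed : ∀ t, ∀ᵐ ω ∂P, φ t ω (q ω) = q (θ t ω)

/-- The skew product `Θ t (ω, x) = (θ t ω, φ t ω x)`. -/
def skewProduct (θ : T → Ω → Ω) (φ : T → Ω → UnitAddCircle ≃ₜ UnitAddCircle) (t : T)
    (p : Ω × UnitAddCircle) : Ω × UnitAddCircle :=
  (θ t p.1, φ t p.1 p.2)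

/-- `μ` is an invariant (probability) measure of `φ`: it has marginal `P` on `Ω` and is invariant
under the skew product. -/
structure IsInvariantMeasure (P : Measure Ω) (θ : T → Ω → Ω)
    (φ : T → Ω → UnitAddCircle ≃ₜ UnitAddCircle) (μ : Measure (Ω × UnitAddCircle)) : Prop where
  isProbabilityMeasure : IsProbabilityMeasure μ
  compatible : ∀ E : Set Ω, MeasurableSet E → μ (E ×ˢ Set.univ) = P E
  invariant : ∀ t, MeasurePreserving (skewProduct θ φ t) μ μ

/-- The random Dirac mass `δ_q`: the law of `ω ↦ (ω, q ω)`. -/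
noncomputable def randomDirac (P : Measure Ω) (q : Ω → UnitAddCircle) :
    Measure (Ω × UnitAddCircle) :=
  P.map (fun ω => (ω, q ω))

end RDS

end CircleRDS

/-!
Let `ν` be an invariant measure that does not charge the graph of the crack point `r`, and let `x`
be a deterministic point with `x ≠ r` almost surely. For a sequence of times `τ n → ∞`, put
`f n ω = φ (τ n) (θ (τ n)⁻¹ ω) x`, which depends only on the past. By invariance, `dist (f n ω) y`
has the same law under `ν` as `dist (φ (τ n) ω x) (φ (τ n) ω y)`, which tends to `0` because neither
`x` nor `y` is the crack point of `ω`. Hence `f n → y` in `ν`-measure, so `ν = δ_a` for an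
almost sure limit `a` of a subsequence, and since `f n` does not involve `ν`, all such `ν` agree.

By ergodicity the restriction of an invariant measure to an invariant set has marginal proportional
to `P`, so every invariant measure is a mixture of one on the graph of `r`, which is `δ_r`, and one
off it. Finally, whether `r ω` lies in a given open set can be read off from the future of `ω`: it
does exactly when the complement of the closure of some small basic open set is contracted.
-/

namespace MetricRDS

open CircleRDS (IsErgodicFlow pastSigma)

section Preliminaries

theorem exists_seq_tendsto_atTop (M : Type*) [AddCommMonoid M] [LinearOrder M]
    [IsOrderedCancelAddMonoid M] [Archimedean M] : ∃ τ : ℕ → M, Tendsto τ atTop atTop := by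
  by_cases h : ∃ r : M, 0 < r
  · obtain ⟨r, hr⟩ := h
    exact ⟨fun n => n • r, tendsto_id.atTop_nsmul_const hr⟩
  · push Not at h
    exact ⟨fun _ => 0, tendsto_atTop.2 fun b => Eventually.of_forall fun _ => h b⟩

theorem exists_pos_le_diam_of_union_eq_univ (X : Type*) [MetricSpace X] [BoundedSpace X]
    [Infinite X] : ∃ δ > 0, ∀ A B : Set X, A ∪ B = Set.univ →
      δ ≤ Metric.diam A ∨ δ ≤ Metric.diam B := by
  obtain ⟨S, hS⟩ := Infinite.exists_subset_card_eq X 3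
  have hS₂ : (S : Set X).Nontrivial := Finset.one_lt_card_iff_nontrivial.1 (by omega)
  have infsep_le_diam {C : Set X} {x y : X} (hx : x ∈ S) (hy : y ∈ S) (hne : x ≠ y)
      (hxC : x ∈ C) (hyC : y ∈ C) : (S : Set X).infsep ≤ Metric.diam C :=
    (Set.infsep_le_dist_of_mem hx hy hne).trans
      (Metric.dist_le_diam_of_mem (Bornology.IsBounded.all C) hxC hyC)
  refine ⟨(S : Set X).infsep, S.infsep_pos_iff_nontrivial.2 hS₂, fun A B hAB => ?_⟩
  classical
  obtain ⟨x, hx, y, hy, hne, hxy⟩ := Finset.exists_ne_map_eq_of_card_lt_of_maps_to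
    (s := S) (t := Finset.univ) (f := fun x => decide (x ∈ A)) (by simp [hS])
    fun _ _ => Finset.mem_coe.2 (Finset.mem_univ _)
  have hmem (z : X) : z ∈ A ∨ z ∈ B := by simp [← Set.mem_union, hAB]
  by_cases hxA : x ∈ A
  · exact Or.inl (infsep_le_diam hx hy hne hxA (by simpa [hxA] using hxy))
  · have hyA : y ∉ A := by simpa [hxA] using hxy
    exact Or.inr (infsep_le_diam hx hy hne ((hmem x).resolve_left hxA) ((hmem y).resolve_left hyA))

theorem union_ne_univ_of_tendsto_diam_image {ι X Y : Type*} [MetricSpace Y] [BoundedSpace Y]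
    [Infinite Y] {l : Filter ι} [l.NeBot] {f : ι → X → Y} (hf : ∀ i, Function.Surjective (f i))
    {A B : Set X} (hA : Tendsto (fun i => Metric.diam (f i '' A)) l (𝓝 0))
    (hB : Tendsto (fun i => Metric.diam (f i '' B)) l (𝓝 0)) : A ∪ B ≠ Set.univ := by
  intro hAB
  obtain ⟨δ, hδ, hdiam⟩ := exists_pos_le_diam_of_union_eq_univ Y
  obtain ⟨i, hiA, hiB⟩ := ((hA.eventually_lt_const hδ).and (hB.eventually_lt_const hδ)).exists
  rcases hdiam (f i '' A) (f i '' B)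
    (by rw [← Set.image_union, hAB, Set.image_univ, (hf i).range_eq]) with h | h
  · exact hiA.not_ge h
  · exact hiB.not_ge h

theorem measurable_diam_image {Ω X Y : Type*} [MeasurableSpace Ω] [TopologicalSpace X]
    [TopologicalSpace.PseudoMetrizableSpace X] [TopologicalSpace.SeparableSpace X]
    [PseudoMetricSpace Y] [SecondCountableTopology Y] [MeasurableSpace Y] [OpensMeasurableSpace Y]
    {f : Ω → X → Y} (hf : ∀ x, Measurable fun ω => f ω x) (hc : ∀ ω, Continuous (f ω))
    (A : Set X) : Measurable fun ω => Metric.diam (f ω '' A) := by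
  obtain ⟨D, hDA, hD, hAD⟩ :=
    (TopologicalSpace.IsSeparable.of_separableSpace A).exists_countable_dense_subset
  have hdiam (ω : Ω) :
      Metric.diam (f ω '' A) = (⨆ x ∈ D, ⨆ y ∈ D, edist (f ω x) (f ω y)).toReal := by
    have hclosure : closure (f ω '' A) = closure (f ω '' D) :=
      (closure_minimal ((Set.image_mono hAD).trans (image_closure_subset_closure_image (hc ω)))
        isClosed_closure).antisymm (closure_mono (Set.image_mono hDA))
    rw [← Metric.diam_closure, hclosure, Metric.diam_closure, Metric.diam, Metric.ediam]
    simp only [iSup_image]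
  simp_rw [hdiam]
  exact (Measurable.biSup D hD fun x _ => Measurable.biSup D hD fun y _ =>
    (hf x).edist (hf y)).ennreal_toReal

theorem exists_forall_ae_ne {Ω X : Type*} [MeasurableSpace Ω] {P : Measure Ω} [SFinite P]
    [MeasurableSpace X] [MeasurableSingletonClass X] [Uncountable X] {r : Ω → X}
    (hr : Measurable r) : ∃ x, ∀ᵐ ω ∂P, x ≠ r ω := by
  have hatoms : {x | 0 < P {ω | r ω = x}}.Countable := Measure.countable_meas_level_set_pos hr
  obtain ⟨x, hx⟩ : ∃ x, P {ω | r ω = x} = 0 := by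
    by_contra! h
    exact Set.not_countable_univ (hatoms.mono fun x _ => pos_iff_ne_zero.2 (h x))
  refine ⟨x, ?_⟩
  filter_upwards [measure_eq_zero_iff_ae_notMem.1 hx] with ω hω using Ne.symm hω

theorem exists_measurable_eqOn {Ω X : Type*} [MeasurableSpace Ω] [TopologicalSpace X]
    [PolishSpace X] [MeasurableSpace X] [BorelSpace X] [Nonempty X] {r : Ω → X} {C : Set Ω}
    (h : ∀ V : Set X, IsOpen V → ∃ E, MeasurableSet E ∧ ∀ ω ∈ C, r ω ∈ V ↔ ω ∈ E) :
    ∃ r' : Ω → X, Measurable r' ∧ Set.EqOn r' r C := by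
  have hrC : Measurable[MeasurableSpace.comap ((↑) : C → Ω) inferInstance]
      fun ω : C => r ω := by
    refine @measurable_of_isOpen _ _ _ _ _ (_) _ fun V hV => ?_
    obtain ⟨E, hE, hEV⟩ := h V hV
    exact ⟨E, hE, by ext ω; exact (hEV ω ω.2).symm⟩
  obtain ⟨r', hr', heq⟩ := hrC.exists_eq_measurable_comp
  exact ⟨r', hr', fun ω hω => (congrFun heq ⟨ω, hω⟩).symm⟩

theorem measurable_limUnder {Ω X : Type*} {_ : MeasurableSpace Ω} [TopologicalSpace X]
    [PolishSpace X] [MeasurableSpace X] [BorelSpace X] [Nonempty X] {f : ℕ → Ω → X}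
    (hf : ∀ n, Measurable (f n)) :
    Measurable fun ω => limUnder atTop fun n => f n ω :=
  (StronglyMeasurable.limUnder fun n => (hf n).stronglyMeasurable).measurable

theorem tendstoInMeasure_of_ae_tendsto_dist_comp {Z X : Type*} [MeasurableSpace Z]
    {μ : Measure Z} [IsFiniteMeasure μ] [PseudoMetricSpace X] [SecondCountableTopology X]
    [MeasurableSpace X] [OpensMeasurableSpace X] {S : ℕ → Z → Z}
    (hS : ∀ n, MeasurePreserving (S n) μ μ) {f : ℕ → Z → X} (hf : ∀ n, Measurable (f n))
    {g : Z → X} (hg : Measurable g)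
    (h : ∀ᵐ z ∂μ, Tendsto (fun n => dist (f n (S n z)) (g (S n z))) atTop (𝓝 0)) :
    TendstoInMeasure μ f atTop g := by
  have hdist : TendstoInMeasure μ (fun n z => dist (f n (S n z)) (g (S n z))) atTop 0 :=
    tendstoInMeasure_of_tendsto_ae (fun n => (((hf n).dist hg).comp
      (hS n).measurable).aestronglyMeasurable) h
  rw [tendstoInMeasure_iff_dist] at hdist ⊢
  intro ε hε
  refine (hdist ε hε).congr fun n => ?_
  rw [← (hS n).measure_preimage
    (measurableSet_le measurable_const ((hf n).dist hg)).nullMeasurableSet]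
  simp

theorem eq_map_of_ae_snd_eq {Ω X : Type*} [MeasurableSpace Ω] [MeasurableSpace X]
    {μ : Measure (Ω × X)} {q : Ω → X} (hq : Measurable q) (h : ∀ᵐ p ∂μ, p.2 = q p.1) :
    μ = μ.fst.map fun ω => (ω, q ω) := by
  have hgraph : Measurable fun ω => (ω, q ω) := measurable_id.prodMk hq
  rw [Measure.fst, Measure.map_map hgraph measurable_fst]
  conv_lhs => rw [← Measure.map_id (μ := μ)]
  refine Measure.map_congr ?_
  filter_upwards [h] with p hp using Prod.ext rfl hp

theorem measurableSet_graph {Ω X : Type*} [MeasurableSpace Ω] [MeasurableSpace X]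
    [MeasurableEq X] {q : Ω → X} (hq : Measurable q) : MeasurableSet (q.graph : Set (Ω × X)) :=
  measurableSet_eq_fun (hq.comp measurable_fst) measurable_snd

theorem smul_cond_add_smul_cond_compl {Z : Type*} [MeasurableSpace Z] (μ : Measure Z)
    [IsFiniteMeasure μ] {S : Set Z} (hS : MeasurableSet S) :
    μ S • μ[|S] + μ Sᶜ • μ[|Sᶜ] = μ := by
  ext E
  simpa [mul_comm] using cond_add_cond_compl_eq hS μ

end Preliminaries

section CrackPoint

variable {Ω X : Type*} {T : AddSubmonoid ℝ≥0} [MetricSpace X]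

/-- The crack point of a sample point in an arbitrary metric state space: the pictures under
`φ t ω` of all sets that stay away from it shrink to a point. -/
def IsCrackPoint (φ : T → Ω → X ≃ₜ X) (ω : Ω) (s : X) : Prop :=
  ∀ A : Set X, s ∉ closure A → Tendsto (fun t : T => Metric.diam (φ t ω '' A)) atTop (𝓝 0)

variable {φ : T → Ω → X ≃ₜ X} {ω : Ω} {s : X}

theorem IsCrackPoint.tendsto_dist (h : IsCrackPoint φ ω s) {x y : X} (hx : x ≠ s) (hy : y ≠ s) :
    Tendsto (fun t => dist (φ t ω x) (φ t ω y)) atTop (𝓝 0) := by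
  have hpair : s ∉ closure {x, y} := by
    rw [(Set.toFinite {x, y}).isClosed.closure_eq]
    simp [hx.symm, hy.symm]
  simpa only [Set.image_pair, Metric.diam_pair] using h {x, y} hpair

variable [BoundedSpace X] [Infinite X]

theorem IsCrackPoint.notMem_interior_of_tendsto_diam (h : IsCrackPoint φ ω s) {ι : Type*}
    {l : Filter ι} [l.NeBot] {τ : ι → T} (hτ : Tendsto τ l atTop) {A : Set X}
    (hA : Tendsto (fun i => Metric.diam (φ (τ i) ω '' A)) l (𝓝 0)) : s ∉ interior A := fun hs =>
  have hAc : s ∉ closure Aᶜ := by rwa [closure_compl, Set.notMem_compl_iff]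
  union_ne_univ_of_tendsto_diam_image (fun i => (φ (τ i) ω).surjective) hA ((h Aᶜ hAc).comp hτ)
    (Set.union_compl_self A)

theorem IsCrackPoint.eq (h : IsCrackPoint φ ω s) {s' : X} (h' : IsCrackPoint φ ω s') :
    s = s' := by
  by_contra hne
  obtain ⟨U, V, hU, hV, hs, hs', hUV⟩ := t2_separation hne
  have hs'U : s' ∉ closure U := fun hmem => (hUV.closure_left hV).le_bot ⟨hmem, hs'⟩
  exact h.notMem_interior_of_tendsto_diam tendsto_id (h' U hs'U) (hU.interior_eq.symm ▸ hs)

theorem IsCrackPoint.mem_iff_exists_tendsto_diam (h : IsCrackPoint φ ω s) {ι : Type*}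
    {l : Filter ι} [l.NeBot] {τ : ι → T} (hτ : Tendsto τ l atTop) {b : Set (Set X)}
    (hb : TopologicalSpace.IsTopologicalBasis b) {V : Set X} (hV : IsOpen V) :
    s ∈ V ↔ ∃ B ∈ b, closure B ⊆ V ∧
      Tendsto (fun i => Metric.diam (φ (τ i) ω '' (closure B)ᶜ)) l (𝓝 0) := by
  constructor
  · intro hs
    obtain ⟨B, hBb, hsB, hBV⟩ := hb.exists_closure_subset (hV.mem_nhds hs)
    have hsB' : s ∉ closure (closure B)ᶜ := by
      rw [closure_compl, Set.notMem_compl_iff]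
      exact interior_maximal subset_closure (hb.isOpen hBb) hsB
    exact ⟨B, hBb, hBV, (h _ hsB').comp hτ⟩
  · rintro ⟨B, -, hBV, hB⟩
    have hsB := h.notMem_interior_of_tendsto_diam hτ hB
    rw [interior_compl, closure_closure, Set.notMem_compl_iff] at hsB
    exact hBV hsB

theorem exists_measurable_eq_of_isCrackPoint [PolishSpace X] [MeasurableSpace X]
    [BorelSpace X] {m' : MeasurableSpace Ω} (hφ : ∀ t x, Measurable[m'] fun ω => φ t ω x)
    (r : Ω → X) :
    ∃ r', Measurable[m'] r' ∧ ∀ ω, IsCrackPoint φ ω (r ω) → r' ω = r ω := by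
  obtain ⟨τ, hτ⟩ := exists_seq_tendsto_atTop T
  refine exists_measurable_eqOn fun V hV => ⟨⋃ B ∈ {B ∈ TopologicalSpace.countableBasis X |
      closure B ⊆ V}, {ω | Tendsto (fun n => Metric.diam (φ (τ n) ω '' (closure B)ᶜ)) atTop (𝓝 0)},
    ?_, fun ω hω => ?_⟩
  · refine .biUnion ((TopologicalSpace.countable_countableBasis X).mono (Set.sep_subset _ _))
      fun B _ => measurableSet_tendsto _ fun n => ?_
    exact measurable_diam_image (hφ (τ n)) (fun ω => (φ (τ n) ω).continuous) _
  · rw [IsCrackPoint.mem_iff_exists_tendsto_diam hω hτ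
      (TopologicalSpace.isBasis_countableBasis X) hV]
    simp only [Set.mem_iUnion, Set.mem_ofPred_eq, exists_prop, and_assoc]

end CrackPoint

section Cocycle

variable {Ω X : Type*} {m : MeasurableSpace Ω} {T : AddSubmonoid ℝ≥0} [MetricSpace X]
  [MeasurableSpace X]

/-- A random dynamical system by homeomorphisms of `X` over the noise `θ`, adapted to `ℱ`, with no
regularity in time. -/
structure IsAdaptedCocycle (ℱ : Filtration T m) (θ : T → Ω → Ω) (φ : T → Ω → X ≃ₜ X) : Prop where
  measurable : ∀ t, Measurable[(ℱ t).prod inferInstance] fun p : Ω × X => φ t p.1 p.2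
  cocycle : ∀ s t ω x, φ (s + t) ω x = φ t (θ s ω) (φ s ω x)

/-- The skew product of the noise `θ` and the cocycle `φ`. -/
def skewProduct (θ : T → Ω → Ω) (φ : T → Ω → X ≃ₜ X) (t : T) (p : Ω × X) : Ω × X :=
  (θ t p.1, φ t p.1 p.2)

variable {ℱ : Filtration T m} {θ : T → Ω → Ω} {φ : T → Ω → X ≃ₜ X}

theorem IsAdaptedCocycle.measurable_apply (hφ : IsAdaptedCocycle ℱ θ φ) (t : T) (x : X) :
    Measurable[ℱ t] fun ω => φ t ω x :=
  let _ : MeasurableSpace Ω := ℱ t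
  (hφ.measurable t).comp measurable_prodMk_right

theorem IsAdaptedCocycle.measurable_uncurry (hφ : IsAdaptedCocycle ℱ θ φ) (t : T) :
    Measurable fun p : Ω × X => φ t p.1 p.2 :=
  (hφ.measurable t).mono (sup_le_sup (MeasurableSpace.comap_mono (ℱ.le t)) le_rfl) le_rfl

theorem IsAdaptedCocycle.measurable_skewProduct (hφ : IsAdaptedCocycle ℱ θ φ) {t : T}
    (hθ : Measurable (θ t)) : Measurable (skewProduct θ φ t) :=
  (hθ.comp measurable_fst).prodMk (hφ.measurable_uncurry t)

theorem IsCrackPoint.map (hφ : IsAdaptedCocycle ℱ θ φ) {ω : Ω} {s : X}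
    (h : IsCrackPoint φ ω s) (t : T) : IsCrackPoint φ (θ t ω) (φ t ω s) := by
  intro A hA
  have hshift : Tendsto (fun u : T => t + u) atTop atTop :=
    tendsto_atTop_mono (fun u => le_add_self (a := (u : ℝ≥0))) tendsto_id
  have himage (u : T) : φ (t + u) ω '' (φ t ω ⁻¹' A) = φ u (θ t ω) '' A := by
    simp_rw [← (φ t ω).image_symm, Set.image_image, hφ.cocycle, Homeomorph.apply_symm_apply]
  simpa only [Function.comp_def, himage] using
    (h (φ t ω ⁻¹' A) (by rwa [← (φ t ω).preimage_closure])).comp hshift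

end Cocycle

section InvariantMeasure

variable {Ω X : Type*} {m : MeasurableSpace Ω} {T : AddSubmonoid ℝ≥0} [MetricSpace X]
  [MeasurableSpace X]

/-- An invariant measure of the random dynamical system `φ`. Its total mass is that of its marginal
`P`, so it is a probability measure whenever `P` is one. -/
structure IsInvariantMeasure (P : Measure Ω) (θ : T → Ω → Ω) (φ : T → Ω → X ≃ₜ X)
    (μ : Measure (Ω × X)) : Prop where
  fst_eq : μ.fst = P
  invariant : ∀ t, MeasurePreserving (skewProduct θ φ t) μ μ

variable {P : Measure Ω} {θ : T → Ω → Ω} {φ : T → Ω → X ≃ₜ X}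
  {μ ν ν₁ ν₂ : Measure (Ω × X)}

theorem eq_smul_of_isErgodicFlow [IsProbabilityMeasure P] (hB : IsErgodicFlow P θ)
    (hθ : ∀ t, MeasurePreserving (θ t) P P) {ρ : Measure Ω} [IsFiniteMeasure ρ] (hρ : ρ ≪ P)
    (hρθ : ∀ t, MeasurePreserving (θ t) ρ ρ) : ρ = ρ Set.univ • P := by
  obtain ⟨c, hc⟩ : ∃ c, ρ.rnDeriv P =ᵐ[P] Function.const Ω c := by
    refine exists_eventuallyEq_const_of_forall_separating MeasurableSet fun U hU => ?_
    have hUm : MeasurableSet (ρ.rnDeriv P ⁻¹' U) := Measure.measurable_rnDeriv ρ P hU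
    have hinv (t : T) : θ t ⁻¹' (ρ.rnDeriv P ⁻¹' U) =ᵐ[P] ρ.rnDeriv P ⁻¹' U :=
      ((hρθ t).rnDeriv_comp_aeEq (hθ t)).preimage U
    rcases hB _ hUm hinv with hnull | hfull
    · exact Or.inr (measure_eq_zero_iff_ae_notMem.1 hnull)
    · exact Or.inl ((mem_ae_iff_prob_eq_one hUm).2 hfull)
  have hρc : ρ = c • P := by
    rw [← Measure.withDensity_rnDeriv_eq ρ P hρ, withDensity_congr_ae hc]
    exact withDensity_const c
  rw [hρc]
  simp

theorem IsInvariantMeasure.isProbabilityMeasure [IsProbabilityMeasure P]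
    (hμ : IsInvariantMeasure P θ φ μ) : IsProbabilityMeasure μ :=
  ⟨by rw [← Measure.fst_univ, hμ.fst_eq, measure_univ]⟩

theorem IsInvariantMeasure.ae_fst (hμ : IsInvariantMeasure P θ φ μ) {p : Ω → Prop}
    (hp : ∀ᵐ ω ∂P, p ω) : ∀ᵐ z ∂μ, p z.1 :=
  ae_of_ae_map measurable_fst.aemeasurable (by rwa [← Measure.fst, hμ.fst_eq])

theorem IsInvariantMeasure.smul_add_smul (hμ : IsInvariantMeasure P θ φ μ)
    (hν : IsInvariantMeasure P θ φ ν) {c d : ENNReal} (hcd : c + d = 1) :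
    IsInvariantMeasure P θ φ (c • μ + d • ν) where
  fst_eq := by
    rw [Measure.fst_add, Measure.fst, Measure.map_smul, Measure.fst, Measure.map_smul,
      ← Measure.fst, ← Measure.fst, hμ.fst_eq, hν.fst_eq, ← add_smul, hcd, one_smul]
  invariant t := ((hμ.invariant t).smul_measure c).add_measure ((hν.invariant t).smul_measure d)

theorem IsInvariantMeasure.cond [IsProbabilityMeasure P] (hμ : IsInvariantMeasure P θ φ μ)
    (hθ : ∀ t, MeasurePreserving (θ t) P P) (hB : IsErgodicFlow P θ) {S : Set (Ω × X)}
    (hS : MeasurableSet S) (hinv : ∀ t, skewProduct θ φ t ⁻¹' S =ᵐ[μ] S) (hS₀ : μ S ≠ 0) :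
    IsInvariantMeasure P θ φ μ[|S] := by
  have := hμ.isProbabilityMeasure
  have := cond_isProbabilityMeasure hS₀
  have hcond (t : T) : MeasurePreserving (skewProduct θ φ t) μ[|S] μ[|S] := by
    have hrestrict := (hμ.invariant t).restrict_preimage hS
    rw [Measure.restrict_congr_set (hinv t)] at hrestrict
    exact hrestrict.smul_measure _
  have hfst (t : T) : MeasurePreserving (θ t) μ[|S].fst μ[|S].fst :=
    (measurable_fst.measurePreserving _).of_semiconj (hcond t) (fun _ => rfl) (hθ t).measurable
  have hac : μ[|S].fst ≪ P :=
    hμ.fst_eq ▸ cond_absolutelyContinuous.map measurable_fst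
  refine ⟨?_, hcond⟩
  rw [eq_smul_of_isErgodicFlow hB hθ hac hfst, measure_univ, one_smul]

theorem IsInvariantMeasure.eq_smul_add_smul [IsProbabilityMeasure P]
    (hμ : IsInvariantMeasure P θ φ μ) (hθ : ∀ t, MeasurePreserving (θ t) P P)
    (hB : IsErgodicFlow P θ) {S : Set (Ω × X)} (hS : MeasurableSet S)
    (hinv : ∀ t, skewProduct θ φ t ⁻¹' S =ᵐ[μ] S)
    (h₁ : ∀ ν, IsInvariantMeasure P θ φ ν → (∀ᵐ p ∂ν, p ∈ S) → ν = ν₁)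
    (h₂ : ∀ ν, IsInvariantMeasure P θ φ ν → (∀ᵐ p ∂ν, p ∉ S) → ν = ν₂) :
    μ = μ S • ν₁ + μ Sᶜ • ν₂ := by
  have := hμ.isProbabilityMeasure
  have hin : μ S • μ[|S] = μ S • ν₁ := by
    rcases eq_or_ne (μ S) 0 with hS₀ | hS₀
    · simp only [hS₀, zero_smul]
    · rw [h₁ _ (hμ.cond hθ hB hS hinv hS₀) (ae_cond_mem hS)]
  have hout : μ Sᶜ • μ[|Sᶜ] = μ Sᶜ • ν₂ := by
    rcases eq_or_ne (μ Sᶜ) 0 with hS₀ | hS₀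
    · simp only [hS₀, zero_smul]
    · rw [h₂ _ (hμ.cond hθ hB hS.compl (fun t => (hinv t).compl) hS₀) (ae_cond_mem hS.compl)]
  rw [← hin, ← hout, smul_cond_add_smul_cond_compl μ hS]

end InvariantMeasure

section RandomFixedPoint

variable {Ω X : Type*} {m : MeasurableSpace Ω} {T : AddSubmonoid ℝ≥0} [MetricSpace X]
  [MeasurableSpace X] {P : Measure Ω} {ℱ : Filtration T m} {θ : T → Ω → Ω}
  {φ : T → Ω → X ≃ₜ X} {μ : Measure (Ω × X)} {q r : Ω → X}

/-- A random fixed point: a random variable whose graph is invariant modulo null sets under the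
skew product. -/
structure IsRandomFixedPoint (P : Measure Ω) (θ : T → Ω → Ω) (φ : T → Ω → X ≃ₜ X)
    (q : Ω → X) : Prop where
  measurable : Measurable q
  fixed : ∀ t, ∀ᵐ ω ∂P, φ t ω (q ω) = q (θ t ω)

/-- The random Dirac mass `δ_q`: the measure with marginal `P` carried by the graph of `q`. -/
noncomputable def randomDirac (P : Measure Ω) (q : Ω → X) : Measure (Ω × X) :=
  P.map fun ω => (ω, q ω)

theorem isRandomFixedPoint_of_ae_isCrackPoint [BoundedSpace X] [Infinite X]
    (hθ : ∀ t, Measure.QuasiMeasurePreserving (θ t) P P) (hφ : IsAdaptedCocycle ℱ θ φ)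
    (hr : Measurable r) (hrc : ∀ᵐ ω ∂P, IsCrackPoint φ ω (r ω)) : IsRandomFixedPoint P θ φ r where
  measurable := hr
  fixed t := by
    filter_upwards [hrc, (hθ t).ae hrc] with ω hω hθω using (hω.map hφ t).eq hθω

theorem IsRandomFixedPoint.preimage_graph_ae_eq (hq : IsRandomFixedPoint P θ φ q)
    (hμ : IsInvariantMeasure P θ φ μ) (t : T) :
    skewProduct θ φ t ⁻¹' q.graph =ᵐ[μ] q.graph := by
  refine eventuallyEq_set.2 ?_
  filter_upwards [hμ.ae_fst (hq.fixed t)] with p hp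
  change q (θ t p.1) = φ t p.1 p.2 ↔ q p.1 = p.2
  rw [← hp, (φ t p.1).injective.eq_iff]

theorem IsInvariantMeasure.eq_randomDirac (hμ : IsInvariantMeasure P θ φ μ) (hq : Measurable q)
    (h : ∀ᵐ p ∂μ, q p.1 = p.2) : μ = randomDirac P q := by
  rw [randomDirac, ← hμ.fst_eq]
  exact eq_map_of_ae_snd_eq hq (h.mono fun _ => Eq.symm)

theorem isInvariantMeasure_randomDirac_iff [MeasurableEq X] (hφ : IsAdaptedCocycle ℱ θ φ)
    (hθ : ∀ t, MeasurePreserving (θ t) P P) (hq : Measurable q) :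
    IsInvariantMeasure P θ φ (randomDirac P q) ↔ IsRandomFixedPoint P θ φ q := by
  have hgraph : Measurable fun ω => (ω, q ω) := measurable_id.prodMk hq
  have hskew (t : T) := hφ.measurable_skewProduct (hθ t).measurable
  constructor
  · refine fun h => ⟨hq, fun t => ?_⟩
    have hmem : ∀ᵐ p ∂randomDirac P q, q p.1 = p.2 :=
      (ae_map_iff hgraph.aemeasurable (measurableSet_graph hq)).2 (ae_of_all P fun _ => rfl)
    have hmem' := (h.invariant t).quasiMeasurePreserving.ae hmem
    exact (ae_of_ae_map hgraph.aemeasurable hmem').mono fun _ => Eq.symm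
  · refine fun h => ⟨(Measure.fst_map_prodMk hq).trans Measure.map_id, fun t => ⟨hskew t, ?_⟩⟩
    have hfixed : skewProduct θ φ t ∘ (fun ω => (ω, q ω)) =ᵐ[P] (fun ω => (ω, q ω)) ∘ θ t := by
      filter_upwards [h.fixed t] with ω hω using Prod.ext rfl hω
    rw [randomDirac, Measure.map_map (hskew t) hgraph, Measure.map_congr hfixed,
      ← Measure.map_map hgraph (hθ t).measurable, (hθ t).map_eq]

end RandomFixedPoint

section Pullback

variable {Ω X : Type*} {m : MeasurableSpace Ω} {T : AddSubmonoid ℝ≥0} [MetricSpace X]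
  {e : T → Ω ≃ᵐ Ω} {φ : T → Ω → X ≃ₜ X}

/-- For automorphisms `e t` of the noise, the pullback of a deterministic point: the state now of
the trajectory that started at `x` at time `-t`. -/
def pullback (e : T → Ω ≃ᵐ Ω) (φ : T → Ω → X ≃ₜ X) (t : T) (x : X) (ω : Ω) : X :=
  φ t ((e t).symm ω) x

theorem pastSigma_le (ℱ : Filtration T m) (e : T → Ω ≃ᵐ Ω) :
    pastSigma ℱ (fun t => e t) ≤ m := by
  refine MeasurableSpace.generateFrom_le ?_
  rintro _ ⟨t, E, hE, rfl⟩
  exact (e t).measurableEmbedding.measurableSet_image' (ℱ.le t E hE)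

variable [MeasurableSpace X] {P : Measure Ω} {ℱ : Filtration T m} {ν : Measure (Ω × X)}
  {r : Ω → X} {x : X}

theorem measurable_pullback (hφ : IsAdaptedCocycle ℱ (fun t => e t) φ) (t : T) (x : X) :
    Measurable[pastSigma ℱ (fun t => e t)] (pullback e φ t x) := fun U hU =>
  have himage : pullback e φ t x ⁻¹' U = e t '' ((fun ω => φ t ω x) ⁻¹' U) := by
    rw [(e t).image_eq_preimage_symm]
    rfl
  MeasurableSpace.measurableSet_generateFrom ⟨t, _, hφ.measurable_apply t x hU, himage⟩

theorem tendstoInMeasure_pullback [SecondCountableTopology X] [BorelSpace X]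
    [IsProbabilityMeasure P] (hφ : IsAdaptedCocycle ℱ (fun t => e t) φ)
    (hν : IsInvariantMeasure P (fun t => e t) φ ν) (hrc : ∀ᵐ ω ∂P, IsCrackPoint φ ω (r ω))
    (hx : ∀ᵐ ω ∂P, x ≠ r ω) (hνr : ∀ᵐ p ∂ν, r p.1 ≠ p.2) {τ : ℕ → T}
    (hτ : Tendsto τ atTop atTop) :
    TendstoInMeasure ν (fun n p => pullback e φ (τ n) x p.1) atTop Prod.snd := by
  have := hν.isProbabilityMeasure
  have hmeas (n : ℕ) : Measurable (pullback e φ (τ n) x) :=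
    (measurable_pullback hφ (τ n) x).mono (pastSigma_le ℱ e) le_rfl
  refine tendstoInMeasure_of_ae_tendsto_dist_comp (fun n => hν.invariant (τ n))
    (fun n => (hmeas n).comp measurable_fst) measurable_snd ?_
  filter_upwards [hν.ae_fst hrc, hν.ae_fst hx, hνr] with p hp hxp hrp
  simpa only [Function.comp_def, skewProduct, pullback, MeasurableEquiv.symm_apply_apply] using
    (hp.tendsto_dist hxp hrp.symm).comp hτ

variable [PolishSpace X] [BorelSpace X] [IsProbabilityMeasure P]

theorem exists_seq_ae_tendsto_pullback (hφ : IsAdaptedCocycle ℱ (fun t => e t) φ)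
    (hν : IsInvariantMeasure P (fun t => e t) φ ν) (hrc : ∀ᵐ ω ∂P, IsCrackPoint φ ω (r ω))
    (hx : ∀ᵐ ω ∂P, x ≠ r ω) (hνr : ∀ᵐ p ∂ν, r p.1 ≠ p.2) :
    ∃ τ : ℕ → T, Tendsto τ atTop atTop ∧
      ∀ᵐ ω ∂P, ∃ y, Tendsto (fun n => pullback e φ (τ n) x ω) atTop (𝓝 y) := by
  obtain ⟨τ, hτ⟩ := exists_seq_tendsto_atTop T
  obtain ⟨n, hn, hlim⟩ := (tendstoInMeasure_pullback hφ hν hrc hx hνr hτ).exists_seq_tendsto_ae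
  refine ⟨τ ∘ n, hτ.comp hn.tendsto_atTop, ?_⟩
  rw [← hν.fst_eq]
  refine (ae_map_iff measurable_fst.aemeasurable (measurableSet_exists_tendsto fun i => ?_)).2
    (hlim.mono fun p hp => ⟨p.2, hp⟩)
  exact (measurable_pullback hφ (τ (n i)) x).mono (pastSigma_le ℱ e) le_rfl

theorem IsInvariantMeasure.eq_randomDirac_limUnder_pullback [Nonempty X]
    (hν : IsInvariantMeasure P (fun t => e t) φ ν) (hφ : IsAdaptedCocycle ℱ (fun t => e t) φ)
    (hrc : ∀ᵐ ω ∂P, IsCrackPoint φ ω (r ω)) (hx : ∀ᵐ ω ∂P, x ≠ r ω)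
    (hνr : ∀ᵐ p ∂ν, r p.1 ≠ p.2) {τ : ℕ → T} (hτ : Tendsto τ atTop atTop)
    (hconv : ∀ᵐ ω ∂P, ∃ y, Tendsto (fun n => pullback e φ (τ n) x ω) atTop (𝓝 y)) :
    ν = randomDirac P fun ω => limUnder atTop fun n => pullback e φ (τ n) x ω := by
  have := hν.isProbabilityMeasure
  have hmeas (n : ℕ) : Measurable (pullback e φ (τ n) x) :=
    (measurable_pullback hφ (τ n) x).mono (pastSigma_le ℱ e) le_rfl
  refine hν.eq_randomDirac (measurable_limUnder hmeas) ?_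
  refine tendstoInMeasure_ae_unique (tendstoInMeasure_of_tendsto_ae (fun n => ?_) ?_)
    (tendstoInMeasure_pullback hφ hν hrc hx hνr hτ)
  · exact ((hmeas n).comp measurable_fst).aestronglyMeasurable
  · filter_upwards [hν.ae_fst hconv] with p hp using tendsto_nhds_limUnder hp

theorem exists_measurable_forall_eq_randomDirac [Uncountable X]
    (hφ : IsAdaptedCocycle ℱ (fun t => e t) φ) (hr : Measurable r)
    (hrc : ∀ᵐ ω ∂P, IsCrackPoint φ ω (r ω))
    (hνr : ∃ ν, IsInvariantMeasure P (fun t => e t) φ ν ∧ ∀ᵐ p ∂ν, r p.1 ≠ p.2) :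
    ∃ a : Ω → X, Measurable[pastSigma ℱ (fun t => e t)] a ∧
      ∀ ν, IsInvariantMeasure P (fun t => e t) φ ν → (∀ᵐ p ∂ν, r p.1 ≠ p.2) →
        ν = randomDirac P a := by
  obtain ⟨ν₀, hν₀, hν₀r⟩ := hνr
  obtain ⟨x, hx⟩ := exists_forall_ae_ne (P := P) hr
  obtain ⟨τ, hτ, hconv⟩ := exists_seq_ae_tendsto_pullback hφ hν₀ hrc hx hν₀r
  exact ⟨_, measurable_limUnder fun n => measurable_pullback hφ (τ n) x, fun ν hν hνr =>
    hν.eq_randomDirac_limUnder_pullback hφ hrc hx hνr hτ hconv⟩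

end Pullback

section Classification

variable {Ω X : Type*} {m : MeasurableSpace Ω} {T : AddSubmonoid ℝ≥0} [MetricSpace X]
  [MeasurableSpace X] {P : Measure Ω} [IsProbabilityMeasure P] {θ : T → Ω → Ω}
  {φ : T → Ω → X ≃ₜ X} {r : Ω → X}

theorem IsInvariantMeasure.eq_smul_randomDirac_add_smul [MeasurableEq X] {μ ν : Measure (Ω × X)}
    (hμ : IsInvariantMeasure P θ φ μ) (hθ : ∀ t, MeasurePreserving (θ t) P P)
    (hB : IsErgodicFlow P θ) (hr : IsRandomFixedPoint P θ φ r)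
    (hν : ∀ ν', IsInvariantMeasure P θ φ ν' → (∀ᵐ p ∂ν', r p.1 ≠ p.2) → ν' = ν) :
    μ = μ r.graph • randomDirac P r + μ (r.graph : Set (Ω × X))ᶜ • ν :=
  hμ.eq_smul_add_smul hθ hB (measurableSet_graph hr.measurable) (hr.preimage_graph_ae_eq hμ)
    (fun _ hν' hgraph => hν'.eq_randomDirac hr.measurable hgraph) hν

theorem setOf_isInvariantMeasure_eq_singleton [MeasurableEq X] {ℱ : Filtration T m}
    (hφ : IsAdaptedCocycle ℱ θ φ) (hθ : ∀ t, MeasurePreserving (θ t) P P)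
    (hB : IsErgodicFlow P θ) (hr : IsRandomFixedPoint P θ φ r)
    (hoff : ¬ ∃ ν, IsInvariantMeasure P θ φ ν ∧ ∀ᵐ p ∂ν, r p.1 ≠ p.2) :
    {μ | IsInvariantMeasure P θ φ μ} = {randomDirac P r} := by
  refine Set.Subset.antisymm (fun μ hμ => ?_) (Set.singleton_subset_iff.2
    ((isInvariantMeasure_randomDirac_iff hφ hθ hr.measurable).2 hr))
  have := IsInvariantMeasure.isProbabilityMeasure hμ
  have hdecomp := hμ.eq_smul_randomDirac_add_smul hθ hB hr (ν := randomDirac P r)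
    fun ν hν hνr => (hoff ⟨ν, hν, hνr⟩).elim
  rwa [← add_smul, measure_add_measure_compl (measurableSet_graph hr.measurable), measure_univ,
    one_smul] at hdecomp

theorem setOf_isInvariantMeasure_eq_segment [MeasurableEq X] {ν : Measure (Ω × X)}
    {ℱ : Filtration T m} (hφ : IsAdaptedCocycle ℱ θ φ)
    (hθ : ∀ t, MeasurePreserving (θ t) P P) (hB : IsErgodicFlow P θ)
    (hr : IsRandomFixedPoint P θ φ r) (hν : IsInvariantMeasure P θ φ ν)
    (huniq : ∀ ν', IsInvariantMeasure P θ φ ν' → (∀ᵐ p ∂ν', r p.1 ≠ p.2) → ν' = ν) :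
    {μ | IsInvariantMeasure P θ φ μ} = {μ | ∃ c ∈ Set.Icc (0 : ℝ) 1,
      μ = ENNReal.ofReal c • randomDirac P r + ENNReal.ofReal (1 - c) • ν} := by
  ext μ
  constructor
  · intro hμ
    have := IsInvariantMeasure.isProbabilityMeasure hμ
    refine ⟨μ.real r.graph, ⟨measureReal_nonneg, measureReal_le_one⟩, ?_⟩
    rw [← probReal_compl_eq_one_sub (measurableSet_graph hr.measurable), ofReal_measureReal,
      ofReal_measureReal]
    exact hμ.eq_smul_randomDirac_add_smul hθ hB hr huniq
  · rintro ⟨c, ⟨hc₀, hc₁⟩, rfl⟩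
    refine ((isInvariantMeasure_randomDirac_iff hφ hθ hr.measurable).2 hr).smul_add_smul hν ?_
    rw [← ENNReal.ofReal_add hc₀ (sub_nonneg.2 hc₁), add_sub_cancel, ENNReal.ofReal_one]

end Classification

end MetricRDS

open MetricRDS in
theorem theorem5p10_general {Ω X : Type*} {m : MeasurableSpace Ω} (P : Measure Ω)
    [IsProbabilityMeasure P] [MetricSpace X] [BoundedSpace X] [PolishSpace X] [Uncountable X]
    [MeasurableSpace X] [BorelSpace X] (T : AddSubmonoid ℝ≥0) (ℱ : Filtration T m)
    (θ : T → Ω → Ω) (hθ : ∀ t, MeasurePreserving (θ t) P P) (hA : CircleRDS.IsTwoSided θ)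
    (hB : CircleRDS.IsErgodicFlow P θ) (φ : T → Ω → X ≃ₜ X) (hφ : IsAdaptedCocycle ℱ θ φ)
    (r : Ω → X) (hr : Measurable r) (hrc : ∀ᵐ ω ∂P, IsCrackPoint φ ω (r ω)) :
    IsRandomFixedPoint P θ φ r ∧
    (∃ r' : Ω → X, Measurable[CircleRDS.futureSigma ℱ] r' ∧ r' =ᵐ[P] r) ∧
    ({μ | IsInvariantMeasure P θ φ μ} = {randomDirac P r} ∨
      ∃ a : Ω → X, Measurable[CircleRDS.pastSigma ℱ θ] a ∧ IsRandomFixedPoint P θ φ a ∧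
        (∀ᵐ ω ∂P, a ω ≠ r ω) ∧
        {μ | IsInvariantMeasure P θ φ μ} =
          {μ | ∃ c ∈ Set.Icc (0 : ℝ) 1,
            μ = ENNReal.ofReal c • randomDirac P r +
              ENNReal.ofReal (1 - c) • randomDirac P a}) := by
  have hrf := isRandomFixedPoint_of_ae_isCrackPoint
    (fun t => (hθ t).quasiMeasurePreserving) hφ hr hrc
  have hfuture (t : T) (x : X) : Measurable[CircleRDS.futureSigma ℱ] fun ω => φ t ω x :=
    (hφ.measurable_apply t x).mono (le_iSup ℱ t) le_rfl
  obtain ⟨r', hr', hrr'⟩ := exists_measurable_eq_of_isCrackPoint hfuture r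
  refine ⟨hrf, ⟨r', hr', hrc.mono hrr'⟩, ?_⟩
  by_cases hoff : ∃ ν, IsInvariantMeasure P θ φ ν ∧ ∀ᵐ p ∂ν, r p.1 ≠ p.2
  · choose e he using hA
    obtain rfl : (fun t => ⇑(e t)) = θ := funext fun t => funext (he t)
    obtain ⟨a, ha, huniq⟩ := exists_measurable_forall_eq_randomDirac hφ hr hrc hoff
    obtain ⟨ν, hν, hνr⟩ := hoff
    obtain rfl := huniq ν hν hνr
    have ham : Measurable a := ha.mono (pastSigma_le ℱ e) le_rfl
    exact Or.inr ⟨a, ha, (isInvariantMeasure_randomDirac_iff hφ hθ ham).1 hν,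
      (ae_of_ae_map (measurable_id.prodMk ham).aemeasurable hνr).mono fun _ => Ne.symm,
      setOf_isInvariantMeasure_eq_segment hφ hθ hB hrf hν huniq⟩
  · exact Or.inl (setOf_isInvariantMeasure_eq_singleton hφ hθ hB hrf hoff)

namespace CircleRDS

theorem uncountable_unitAddCircle : Uncountable UnitAddCircle := by
  rw [← Cardinal.aleph0_lt_mk_iff, Cardinal.mk_congr (AddCircle.equivIco (1 : ℝ) 0),
    Cardinal.mk_Ico_real (by norm_num)]
  exact Cardinal.aleph0_lt_continuum

variable {Ω : Type*} {m : MeasurableSpace Ω} {P : Measure Ω} {T : AddSubmonoid ℝ≥0}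
  {θ : T → Ω → Ω} {φ : T → Ω → UnitAddCircle ≃ₜ UnitAddCircle}

theorem isRandomFixedPoint_iff {q : Ω → UnitAddCircle} :
    IsRandomFixedPoint P θ φ q ↔ MetricRDS.IsRandomFixedPoint P θ φ q :=
  ⟨fun h => ⟨h.measurable, h.fixed⟩, fun h => ⟨h.measurable, h.fixed⟩⟩

theorem isInvariantMeasure_iff [IsProbabilityMeasure P] {μ : Measure (Ω × UnitAddCircle)} :
    IsInvariantMeasure P θ φ μ ↔ MetricRDS.IsInvariantMeasure P θ φ μ := by
  have hprod (E : Set Ω) : E ×ˢ (Set.univ : Set UnitAddCircle) = Prod.fst ⁻¹' E := Set.prod_univ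
  constructor
  · refine fun h => ⟨Measure.ext fun E hE => ?_, h.invariant⟩
    rw [Measure.fst_apply hE, ← hprod, h.compatible E hE]
  · refine fun h => ⟨h.isProbabilityMeasure, fun E hE => ?_, h.invariant⟩
    rw [hprod, ← Measure.fst_apply hE, h.fst_eq]

end CircleRDS

theorem theorem5p10 {Ω : Type*} {m : MeasurableSpace Ω} (P : Measure Ω) [IsProbabilityMeasure P]
    (T : AddSubmonoid ℝ≥0) (hT : CircleRDS.IsTimeSet T)
    (ℱ : Filtration T m) (θ : T → Ω → Ω) (hθ : CircleRDS.IsMemorylessNoise P ℱ θ)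
    (hA : CircleRDS.IsTwoSided θ) (hB : CircleRDS.IsErgodicFlow P θ)
    (φ : T → Ω → UnitAddCircle ≃ₜ UnitAddCircle) (hφ : CircleRDS.IsRDS ℱ θ φ)
    (hc : ∀ᵐ ω ∂P, ω ∈ CircleRDS.contractiveSet φ)
    (r : Ω → UnitAddCircle) (hr : Measurable r)
    (hrc : ∀ ω ∈ CircleRDS.contractiveSet φ, CircleRDS.IsCrackPoint φ ω (r ω)) :
    CircleRDS.IsRandomFixedPoint P θ φ r ∧
    (∃ r' : Ω → UnitAddCircle, Measurable[CircleRDS.futureSigma ℱ] r' ∧ r' =ᵐ[P] r) ∧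
    ({μ | CircleRDS.IsInvariantMeasure P θ φ μ} = {CircleRDS.randomDirac P r} ∨
      ∃ a : Ω → UnitAddCircle,
        Measurable[CircleRDS.pastSigma ℱ θ] a ∧
        CircleRDS.IsRandomFixedPoint P θ φ a ∧
        (∀ᵐ ω ∂P, a ω ≠ r ω) ∧
        {μ | CircleRDS.IsInvariantMeasure P θ φ μ} =
          {μ | ∃ c ∈ Set.Icc (0 : ℝ) 1,
            μ = ENNReal.ofReal c • CircleRDS.randomDirac P r +
              ENNReal.ofReal (1 - c) • CircleRDS.randomDirac P a}) := by
  have := CircleRDS.uncountable_unitAddCircle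
  simp only [CircleRDS.isRandomFixedPoint_iff, CircleRDS.isInvariantMeasure_iff]
  exact theorem5p10_general P T ℱ θ hθ.measurePreserving hA hB φ ⟨hφ.measurable, hφ.cocycle⟩ r hr
    (hc.mono hrc)
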